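/- Let $p,q,r\ge 0$ with $p+q+r=1$ and $r<1$, and let $s\in[0,1]$. Let $(X_n)_{n\ge 1}$ be the steps of the elephant random walk with stops: $X_1$ equals $1$ with probability $s$ and $-1$ with probability $1-s$; and for every $n\ge 1$, given $X_1,\dots,X_n$, an index $k$ is chosen uniformly at random in $\{1,\dots,n\}$ and $X_{n+1}$ equals $+X_k$ with probability $p$, $-X_k$ with probability $q$, and $0$ with probability $r$. Let $\Sigma_n=\sum_{k=1}^n X_k^2$ be the number of ones up to time $n$. Then there is a random variable $\Sigma$ on the same probability space such that $$\lim_{n\to\infty}\frac{\Sigma_n}{n^{1-r}}=\Sigma\quad\text{almost surely},$$ and the convergence also holds in $\mathbb{L}^m$ for every integer $m\ge 1$. Moreover $\Sigma>0$ almost surely, and $\Sigma$ has the Mittag-Leffler distribution with parameter $1-r$, that is, for every $t\in\mathbb{R}$, $$\mathbb{E}[\exp(t\Sigma)]=\sum_{n=0}^{\infty}\frac{t^n}{\Gamma(1+n(1-r))}$$ (with finite expectation and convergent series). In particular, for every integer $m\ge 1$, $$\mathbb{E}[\Sigma^m]=\frac{m!}{\Gamma(1+m(1-r))}.$$ -/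

import Mathlib

open MeasureTheory ProbabilityTheory Filter Topology

noncomputable section

/-- Conditional probability that step number `n + 1` equals `y`, given that the steps
`1, …, n` are `x 1, …, x n`: an index `k` is chosen uniformly at random in `{1, …, n}`, and
the new step is `x k` with probability `p`, `-x k` with probability `q`, and `0` with
probability `r` (two or three of these values may coincide, the probabilities then add up). -/
def erwsStepProb (p q r : ℝ) (n : ℕ) (x : ℕ → ℝ) (y : ℝ) : ℝ :=
  ∑ k ∈ Finset.Icc 1 n, (1 / (n : ℝ)) *
    (p * (if y = x k then 1 else 0) + q * (if y = -x k then 1 else 0)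
      + r * (if y = 0 then 1 else 0))

/-- `X 1, X 2, …` are the steps of an elephant random walk with stops with parameters `p, q, r`
whose first step has the Rademacher distribution `R(s)`, under the probability measure `μ`.
The law of the process is given by the law of the first step and the conditional law of each
step given all the previous ones. -/
structure IsERWS {Ω : Type*} [MeasurableSpace Ω] (μ : Measure Ω) (p q r s : ℝ)
    (X : ℕ → Ω → ℝ) : Prop where
  measurable : ∀ n, Measurable (X n)
  start : ∀ᵐ ω ∂μ, X 0 ω = 0
  first_right : μ.real {ω | X 1 ω = 1} = s
  first_left : μ.real {ω | X 1 ω = -1} = 1 - s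
  step : ∀ n : ℕ, 1 ≤ n → ∀ x : ℕ → ℝ,
    μ.real {ω | ∀ k ∈ Finset.Icc 1 (n + 1), X k ω = x k}
      = μ.real {ω | ∀ k ∈ Finset.Icc 1 n, X k ω = x k} * erwsStepProb p q r n x (x (n + 1))

/-- The number of ones `Σ_n = ∑_{k=1}^n X_k ^ 2` up to time `n`. -/
def numOnes {Ω : Type*} (X : ℕ → Ω → ℝ) (n : ℕ) (ω : Ω) : ℝ :=
  ∑ k ∈ Finset.Icc 1 n, X k ω ^ 2

/-- The random variable `Y` is positive and has the Mittag-Leffler distribution with parameter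
`α ∈ (0, 1]`: for every real `t`, `E[exp (t Y)]` is finite and equal to
`E_α(t) = ∑_{n ≥ 0} t ^ n / Γ(1 + n α)`, the series being convergent. -/
structure IsMittagLeffler {Ω : Type*} [MeasurableSpace Ω] (μ : Measure Ω) (α : ℝ)
    (Y : Ω → ℝ) : Prop where
  aemeasurable : AEMeasurable Y μ
  pos : ∀ᵐ ω ∂μ, 0 < Y ω
  integrable : ∀ t : ℝ, Integrable (fun ω => Real.exp (t * Y ω)) μ
  laplace : ∀ t : ℝ,
    HasSum (fun n : ℕ => t ^ n / Real.Gamma (1 + n * α)) (∫ ω, Real.exp (t * Y ω) ∂μ)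

end

/-! Given the past, `Σ_n` grows by one with probability `(1 - r) Σ_n / n`. The function `risingPow m
s = Γ(s + m) / Γ(s)` is multiplied by `1 + m / s` when `s` grows by one, so the factor `Σ_n`
cancels: conditioning multiplies `risingPow m Σ_n` by the deterministic factor `1 + (1 - r) m / n`,
for every real `m > -1` (`integral_risingPow`). Euler's product turns the resulting product into
`Γ(1 + m) / Γ(1 + (1 - r) m)` times `n ^ ((1 - r) m)`.

Each choice of `m` gives one conclusion. For `m = 1` a positive martingale appears and converges
almost surely (`exists_tendsto_numOnes`). Natural `m` gives the moments of the limit and the `L^m`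
bounds (`limit_moment`, `exists_moment_bound`). The value `m = -1/2` bounds a negative moment, so by
Fatou the limit cannot vanish (`limit_pos`). Summing the moments gives the Mittag-Leffler series
(`limit_exp_hasSum`). -/

/-! ### Moment bounds and uniform integrability. -/

/-- A sequence bounded in `L^(m+1)` that converges almost surely also converges in `L^m`. -/
lemma tendsto_eLpNorm_of_moment_bound {Ω : Type*} [MeasurableSpace Ω] {μ : Measure Ω}
    [IsProbabilityMeasure μ] {V : ℕ → Ω → ℝ} {Y : Ω → ℝ} {m : ℕ} (hm : 1 ≤ m)
    (hV : ∀ n, AEStronglyMeasurable (V n) μ) {C : ℝ}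
    (hint : ∀ n, Integrable (fun ω => |V n ω| ^ (m + 1)) μ)
    (hbd : ∀ n, ∫ ω, |V n ω| ^ (m + 1) ∂μ ≤ C)
    (hlim : ∀ᵐ ω ∂μ, Tendsto (fun n => V n ω) atTop (𝓝 (Y ω))) :
    MemLp Y m μ ∧ Tendsto (fun n => eLpNorm (fun ω => V n ω - Y ω) m μ) atTop (𝓝 0) := by
  have hm1 : (1 : ENNReal) ≤ (m : ENNReal) := by exact_mod_cast hm
  have hm0 : (m : ENNReal) ≠ 0 := by positivity
  have hmt : (m : ENNReal) ≠ ⊤ := ENNReal.natCast_ne_top m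
  have hC : 0 ≤ C := (integral_nonneg fun ω => by positivity).trans (hbd 0)
  have hui : UniformIntegrable V m μ := by
    refine uniformIntegrable_of hm1 hmt hV fun ε hε => ?_
    -- Where `|V| ≥ K`, `|V|^m ≤ |V|^(m+1) / K`, of integral at most `C / K ≤ ε^m`; the `+ 1` keeps
    -- `K` positive.
    set K : ℝ := (C + 1) / ε ^ m with hK
    have hKpos : 0 < K := by positivity
    refine ⟨⟨K, hKpos.le⟩, fun n => ?_⟩
    rw [eLpNorm_eq_lintegral_rpow_enorm_toReal hm0 hmt]
    simp only [ENNReal.toReal_natCast, ENNReal.rpow_natCast]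
    rw [one_div, ENNReal.rpow_inv_le_iff (by positivity), ENNReal.rpow_natCast,
      ← ENNReal.ofReal_pow hε.le]
    have hpt : ∀ ω, ‖({x | (⟨K, hKpos.le⟩ : NNReal) ≤ ‖V n x‖₊}.indicator (V n)) ω‖ₑ ^ m
        ≤ ENNReal.ofReal (|V n ω| ^ (m + 1) / K) := by
      intro ω
      by_cases h : (⟨K, hKpos.le⟩ : NNReal) ≤ ‖V n ω‖₊
      · rw [Set.indicator_of_mem (by exact h), Real.enorm_eq_ofReal_abs,
          ← ENNReal.ofReal_pow (abs_nonneg _)]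
        apply ENNReal.ofReal_le_ofReal
        have h' : K ≤ |V n ω| := by exact_mod_cast h
        rw [le_div_iff₀ hKpos, pow_succ]
        gcongr
      · rw [Set.indicator_of_notMem (by exact h)]
        simp [show m ≠ 0 by omega]
    refine (lintegral_mono hpt).trans ?_
    rw [← ofReal_integral_eq_lintegral_ofReal ((hint n).div_const K)
      (ae_of_all _ fun ω => by positivity), integral_div]
    apply ENNReal.ofReal_le_ofReal
    rw [div_le_iff₀ hKpos, hK, mul_div_cancel₀ _ (by positivity)]
    linarith [hbd n]
  have hY : MemLp Y m μ := hui.memLp_of_ae_tendsto hlim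
  exact ⟨hY, tendsto_Lp_finite_of_tendsto_ae hm1 hmt hV hY
    hui.unifIntegrable hlim⟩

/-- An `L²`-bounded sequence that converges almost surely has convergent expectations. -/
lemma tendsto_integral_of_sq_bound {Ω : Type*} [MeasurableSpace Ω] {μ : Measure Ω}
    [IsProbabilityMeasure μ] {V : ℕ → Ω → ℝ} {Y : Ω → ℝ}
    {C : ℝ} (hint1 : ∀ n, Integrable (V n) μ)
    (hint : ∀ n, Integrable (fun ω => |V n ω| ^ 2) μ)
    (hbd : ∀ n, ∫ ω, |V n ω| ^ 2 ∂μ ≤ C)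
    (hlim : ∀ᵐ ω ∂μ, Tendsto (fun n => V n ω) atTop (𝓝 (Y ω))) :
    Integrable Y μ ∧ Tendsto (fun n => ∫ ω, V n ω ∂μ) atTop (𝓝 (∫ ω, Y ω ∂μ)) := by
  obtain ⟨h1, h2⟩ := tendsto_eLpNorm_of_moment_bound (m := 1) le_rfl (fun n => (hint1 n).1) hint hbd hlim
  have h3 : Integrable Y μ := memLp_one_iff_integrable.mp (by simpa using h1)
  refine ⟨h3, tendsto_integral_of_L1' Y h3.1 (Eventually.of_forall hint1) ?_⟩
  simpa [Pi.sub_def] using h2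

/-! ### Gamma asymptotics and the Mittag-Leffler series. -/

/-- Euler's product for the Gamma function: `∏_{k=1}^n (1 + s/k) ~ (n+1)^s / Γ(1+s)`. -/
lemma tendsto_prod_one_add_div {s : ℝ} (hs : -1 < s) :
    Tendsto (fun n : ℕ => (∏ k ∈ Finset.range n, (1 + s / ((k : ℝ) + 1))) / ((n : ℝ) + 1) ^ s)
      atTop (𝓝 (1 / Real.Gamma (1 + s))) := by
  rcases eq_or_ne s 0 with rfl | hs0
  · simp
  have hpos : ∀ k : ℕ, 0 < s + ((k : ℝ) + 1) := fun k => by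
    have : (0 : ℝ) ≤ k := k.cast_nonneg
    linarith
  have hG : Real.Gamma (1 + s) = s * Real.Gamma s := by
    rw [add_comm, Real.Gamma_add_one hs0]
  have hGpos : 0 < Real.Gamma (1 + s) := Real.Gamma_pos_of_pos (by linarith)
  have h1 : Tendsto (fun n : ℕ => 1 / (s * Real.GammaSeq s n)) atTop
      (𝓝 (1 / Real.Gamma (1 + s))) := by
    refine tendsto_const_nhds.div ?_ hGpos.ne'
    rw [hG]
    exact (Real.GammaSeq_tendsto_Gamma s).const_mul s
  have hprod : ∀ n : ℕ, ∏ j ∈ Finset.range (n + 1), (s + j)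
      = s * n.factorial * ∏ k ∈ Finset.range n, (1 + s / ((k : ℝ) + 1)) := by
    intro n
    induction n with
    | zero => simp
    | succ n ih =>
      rw [Finset.prod_range_succ, ih, Finset.prod_range_succ _ n, Nat.factorial_succ]
      push_cast
      field_simp
      ring
  -- `GammaSeq s (n + 1)` carries the power `(n + 1)^s` but `n + 1` factors; the division removes
  -- the last one, which tends to 1.
  have h2 : ∀ n : ℕ, 1 / (s * Real.GammaSeq s (n + 1)) / (1 + s / ((n : ℝ) + 1))
      = (∏ k ∈ Finset.range n, (1 + s / ((k : ℝ) + 1))) / ((n : ℝ) + 1) ^ s := by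
    intro n
    have hf : (1 + s / ((n : ℝ) + 1)) ≠ 0 := by
      have := hpos n
      have h : 1 + s / ((n : ℝ) + 1) = (s + (n + 1)) / (n + 1) := by field_simp; ring
      rw [h]; positivity
    have hr : (0 : ℝ) < ((n : ℝ) + 1) ^ s := by positivity
    have hfac : ((n + 1).factorial : ℝ) ≠ 0 := by positivity
    rw [Real.GammaSeq, hprod, Finset.prod_range_succ]
    push_cast
    generalize (∏ k ∈ Finset.range n, (1 + s / ((k : ℝ) + 1))) = P
    generalize (1 + s / ((n : ℝ) + 1)) = Q at hf
    generalize ((n : ℝ) + 1) ^ s = R at hr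
    generalize ((n + 1).factorial : ℝ) = F at hfac
    rcases eq_or_ne P 0 with rfl | hP
    · simp
    field_simp
  have h3 : Tendsto (fun n : ℕ => 1 + s / ((n : ℝ) + 1)) atTop (𝓝 1) := by
    have : Tendsto (fun n : ℕ => s / ((n : ℝ) + 1)) atTop (𝓝 0) :=
      tendsto_const_nhds.div_atTop
        (tendsto_atTop_add_const_right _ _ tendsto_natCast_atTop_atTop)
    simpa using this.const_add 1
  have h4 := (h1.comp (tendsto_add_atTop_nat 1)).div h3 one_ne_zero
  rw [div_one] at h4
  exact h4.congr fun n => h2 n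

/-- Keep only `u > A` in the Gamma integral, where `u^x ≥ A^x`. As `A` is free, Gamma beats any
geometric growth. -/
lemma Real.rpow_mul_exp_neg_le_Gamma_one_add {A x : ℝ} (hA : 0 < A) (hx : 0 ≤ x) :
    A ^ x * Real.exp (-A) ≤ Real.Gamma (1 + x) := by
  have hint := Real.GammaIntegral_convergent (s := 1 + x) (by linarith)
  have hsub : Set.Ioi A ⊆ Set.Ioi (0 : ℝ) := Set.Ioi_subset_Ioi hA.le
  rw [Real.Gamma_eq_integral (by linarith)]
  calc A ^ x * Real.exp (-A) = ∫ u in Set.Ioi A, A ^ x * Real.exp (-u) := by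
        rw [integral_const_mul, integral_exp_neg_Ioi]
    _ ≤ ∫ u in Set.Ioi A, Real.exp (-u) * u ^ (1 + x - 1) := by
        refine setIntegral_mono_on ((integrableOn_exp_neg_Ioi A).const_mul _)
          (hint.mono_set hsub) measurableSet_Ioi fun u hu => ?_
        rw [mul_comm, add_sub_cancel_left]
        gcongr
        exact (Set.mem_Ioi.mp hu).le
    _ ≤ _ := by
        refine setIntegral_mono_set hint ?_ hsub.eventuallyLE
        refine (ae_restrict_iff' measurableSet_Ioi).mpr (ae_of_all _ fun u hu => ?_)
        have : (0 : ℝ) < u := hu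
        simp only [Pi.zero_apply]
        positivity

/-- The Mittag-Leffler series converges absolutely on the whole line. -/
lemma summable_mittagLeffler {α : ℝ} (hα : 0 < α) (t : ℝ) :
    Summable (fun n : ℕ => |t| ^ n / Real.Gamma (1 + n * α)) := by
  -- Chosen so that `A^α = 2|t| + 1`: the terms are then dominated by a geometric series of ratio
  -- below 1.
  set A : ℝ := (2 * |t| + 1) ^ (1 / α) with hAdef
  have hB : 0 < 2 * |t| + 1 := by positivity
  have hA : 0 < A := by positivity
  have hAα : A ^ α = 2 * |t| + 1 := by
    rw [hAdef, ← Real.rpow_mul hB.le, one_div_mul_cancel hα.ne', Real.rpow_one]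
  have hq : |t| / (2 * |t| + 1) < 1 := by
    rw [div_lt_one hB]; linarith [abs_nonneg t]
  refine Summable.of_nonneg_of_le (fun n => ?_) (fun n => ?_)
    ((summable_geometric_of_lt_one (by positivity) hq).mul_left (Real.exp A))
  · have : 0 < Real.Gamma (1 + n * α) := Real.Gamma_pos_of_pos (by positivity)
    positivity
  · have h := Real.rpow_mul_exp_neg_le_Gamma_one_add hA (x := n * α) (by positivity)
    rw [mul_comm (n : ℝ) α, Real.rpow_mul hA.le, hAα, Real.rpow_natCast, mul_comm α] at h
    calc |t| ^ n / Real.Gamma (1 + n * α)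
        ≤ |t| ^ n / ((2 * |t| + 1) ^ n * Real.exp (-A)) := by gcongr
      _ = _ := by rw [Real.exp_neg, div_pow]; field_simp

/-! ### Rising factorial powers. -/

/-- The rising factial power `s (s + 1) ⋯ (s + m - 1)`, for real `m`. -/
noncomputable def risingPow (m s : ℝ) : ℝ := Real.Gamma (s + m) / Real.Gamma s

/-- The increment carries the factor `1 / s`, which later cancels against a growth probability
proportional to `s`. -/
lemma risingPow_add_one {m s : ℝ} (hs : 0 < s) (hsm : 0 < s + m) :
    risingPow m (s + 1) = risingPow m s + m / s * risingPow m s := by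
  have h := (Real.Gamma_pos_of_pos hs).ne'
  rw [risingPow, risingPow, add_right_comm, Real.Gamma_add_one hsm.ne', Real.Gamma_add_one hs.ne']
  field_simp

lemma risingPow_zero {s : ℝ} (hs : 0 < s) : risingPow 0 s = 1 := by
  rw [risingPow, add_zero, div_self (Real.Gamma_pos_of_pos hs).ne']

lemma risingPow_nat_succ (m : ℕ) {s : ℝ} (hs : 0 < s) :
    risingPow ((m + 1 : ℕ) : ℝ) s = risingPow m s * (s + m) := by
  rw [risingPow, risingPow, Nat.cast_add, Nat.cast_one, ← add_assoc,
    Real.Gamma_add_one (by positivity)]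
  ring

lemma risingPow_pos {m s : ℝ} (hs : 0 < s) (hsm : 0 < s + m) : 0 < risingPow m s :=
  div_pos (Real.Gamma_pos_of_pos hsm) (Real.Gamma_pos_of_pos hs)

lemma pow_le_risingPow (m : ℕ) {s : ℝ} (hs : 0 < s) : s ^ m ≤ risingPow m s := by
  induction m with
  | zero => simp [risingPow_zero hs]
  | succ m ih =>
    rw [risingPow_nat_succ m hs, pow_succ]
    have : (0 : ℝ) ≤ m := m.cast_nonneg
    exact mul_le_mul ih (by linarith) hs.le (risingPow_pos hs (by linarith)).le

lemma risingPow_le_factorial_mul_pow (m : ℕ) {s : ℝ} (hs : 1 ≤ s) :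
    risingPow m s ≤ m.factorial * s ^ m := by
  have hs0 : 0 < s := by linarith
  induction m with
  | zero => simp [risingPow_zero hs0]
  | succ m ih =>
    rw [risingPow_nat_succ m hs0, pow_succ, Nat.factorial_succ]
    have hm : (0 : ℝ) ≤ m := m.cast_nonneg
    have h1 : s + m ≤ (m + 1) * s := by nlinarith
    calc risingPow m s * (s + m) ≤ (m.factorial * s ^ m) * ((m + 1) * s) := by gcongr
      _ = _ := by push_cast; ring

/-- Log-convexity of Gamma at `s`, the midpoint of `s - 1/2` and `s + 1/2`, gives `Γ(s) ≤ Γ(s - 1/2)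
√(s - 1/2)`. -/
lemma inv_sqrt_le_risingPow_neg_half {s : ℝ} (hs : 1 ≤ s) :
    (√s)⁻¹ ≤ risingPow (-(1 / 2)) s := by
  have hs0 : 0 < s := by linarith
  have hh : 0 < s + -(1 / 2) := by linarith
  have hG := Real.Gamma_pos_of_pos hs0
  have hG' := Real.Gamma_pos_of_pos hh
  have h := Real.Gamma_mul_add_mul_le_rpow_Gamma_mul_rpow_Gamma (s := s + -(1 / 2))
    (t := s + -(1 / 2) + 1) (a := 1 / 2) (b := 1 / 2) hh (by linarith) (by norm_num)
    (by norm_num) (by norm_num)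
  rw [Real.Gamma_add_one hh.ne', Real.mul_rpow hh.le hG'.le,
    show 1 / 2 * (s + -(1 / 2)) + 1 / 2 * (s + -(1 / 2) + 1) = s by ring] at h
  simp only [← Real.sqrt_eq_rpow] at h
  rw [risingPow, inv_le_iff_one_le_mul₀ (by positivity), div_mul_eq_mul_div, le_div_iff₀ hG, one_mul]
  calc Real.Gamma s ≤ _ := h
    _ = Real.Gamma (s + -(1 / 2)) * √(s + -(1 / 2)) := by
        rw [mul_left_comm, Real.mul_self_sqrt hG'.le, mul_comm]
    _ ≤ _ := by gcongr; linarith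

/-! ### Expectations of finitely valued variables. -/

section FinitelyValued

variable {Ω β : Type*} [MeasurableSpace Ω] {μ : Measure Ω} {V : Ω → β} {T : Finset β}

/-- Almost surely `φ ∘ V` is a finite sum of indicators, so no measurability of `φ` is ever needed.
-/
lemma ae_eq_sum_indicator (hT : ∀ᵐ ω ∂μ, V ω ∈ T) (φ : β → ℝ) :
    (fun ω => φ (V ω)) =ᵐ[μ] fun ω => ∑ x ∈ T, (V ⁻¹' {x}).indicator (fun _ => φ x) ω := by
  classical
  filter_upwards [hT] with ω hω
  rw [Finset.sum_eq_single_of_mem _ hω]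
  · simp
  · intro x _ hx
    exact Set.indicator_of_notMem (by simpa using hx.symm) _

variable [MeasurableSpace β] [MeasurableSingletonClass β]

lemma integrable_comp_of_finite [IsFiniteMeasure μ] (hV : Measurable V)
    (hT : ∀ᵐ ω ∂μ, V ω ∈ T) (φ : β → ℝ) : Integrable (fun ω => φ (V ω)) μ :=
  (integrable_finsetSum T fun x _ => (integrable_const (φ x)).indicator
    (hV (measurableSet_singleton x))).congr (ae_eq_sum_indicator hT φ).symm

lemma integral_comp_of_finite [IsFiniteMeasure μ] (hV : Measurable V)
    (hT : ∀ᵐ ω ∂μ, V ω ∈ T) (φ : β → ℝ) :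
    ∫ ω, φ (V ω) ∂μ = ∑ x ∈ T, μ.real (V ⁻¹' {x}) * φ x := by
  rw [integral_congr_ae (ae_eq_sum_indicator hT φ), integral_finsetSum T fun x _ =>
    (integrable_const (φ x)).indicator (hV (measurableSet_singleton x))]
  refine Finset.sum_congr rfl fun x _ => ?_
  rw [integral_indicator_const _ (hV (measurableSet_singleton x)), smul_eq_mul]

end FinitelyValued

/-! ### Finite paths and their step probabilities. -/

/-- The first `n` steps of a walk, extended by zero. -/
noncomputable def pathUpTo {Ω : Type*} (X : ℕ → Ω → ℝ) (n : ℕ) (ω : Ω) : ℕ → ℝ :=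
  fun k => if k ∈ Finset.Icc 1 n then X k ω else 0

/-- The possible values of a single step. -/
noncomputable def stepValues : Finset ℝ := {-1, 0, 1}

open Classical in
/-- The possible values of the first `n` steps. -/
noncomputable def pathValues : ℕ → Finset (ℕ → ℝ)
  | 0 => {0}
  | n + 1 => (pathValues n ×ˢ stepValues).image fun z => Function.update z.1 (n + 1) z.2

/-- The number of ones of a path. -/
noncomputable def pathOnes (n : ℕ) (x : ℕ → ℝ) : ℝ := ∑ k ∈ Finset.Icc 1 n, x k ^ 2

lemma mem_stepValues {y : ℝ} : y ∈ stepValues ↔ y = -1 ∨ y = 0 ∨ y = 1 := by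
  simp [stepValues]

lemma mem_pathValues {n : ℕ} {x : ℕ → ℝ} (hx : x ∈ pathValues n) (k : ℕ) :
    x k ∈ stepValues ∧ (k ∉ Finset.Icc 1 n → x k = 0) := by
  induction n generalizing x with
  | zero =>
    obtain rfl : x = 0 := by simpa [pathValues] using hx
    simp [mem_stepValues]
  | succ n ih =>
    simp only [pathValues, Finset.mem_image, Finset.mem_product, Prod.exists] at hx
    obtain ⟨z, y, ⟨hz, hy⟩, rfl⟩ := hx
    rcases eq_or_ne k (n + 1) with rfl | hk
    · simp [hy]
    · rw [Function.update_of_ne hk]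
      refine ⟨(ih hz).1, fun h => (ih hz).2 fun h' => h ?_⟩
      simp only [Finset.mem_Icc] at h' ⊢
      omega

section Path

variable {Ω : Type*} {X : ℕ → Ω → ℝ}

lemma pathUpTo_succ (n : ℕ) (ω : Ω) :
    pathUpTo X (n + 1) ω = Function.update (pathUpTo X n ω) (n + 1) (X (n + 1) ω) := by
  funext k
  rcases eq_or_ne k (n + 1) with rfl | hk
  · simp [pathUpTo]
  · rw [Function.update_of_ne hk]
    have : k ∈ Finset.Icc 1 (n + 1) ↔ k ∈ Finset.Icc 1 n := by
      simp only [Finset.mem_Icc]; omega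
    simp only [pathUpTo, this]

lemma pathOnes_pathUpTo (n : ℕ) (ω : Ω) : pathOnes n (pathUpTo X n ω) = numOnes X n ω :=
  Finset.sum_congr rfl fun k hk => by simp only [pathUpTo, if_pos hk]

lemma numOnes_succ (n : ℕ) (ω : Ω) : numOnes X (n + 1) ω = numOnes X n ω + X (n + 1) ω ^ 2 := by
  rw [numOnes, Finset.sum_Icc_succ_top (by omega), numOnes]

lemma preimage_pathUpTo {n : ℕ} {x : ℕ → ℝ} (hx : ∀ k, k ∉ Finset.Icc 1 n → x k = 0) :
    pathUpTo X n ⁻¹' {x} = {ω | ∀ k ∈ Finset.Icc 1 n, X k ω = x k} := by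
  ext ω
  simp only [Set.mem_preimage, Set.mem_singleton_iff, Set.mem_ofPred_eq, funext_iff, pathUpTo]
  refine ⟨fun h k hk => by rw [← h k, if_pos hk], fun h k => ?_⟩
  split_ifs with hk
  · exact h k hk
  · exact (hx k hk).symm

end Path

/-- The probabilities of the three possible values of the next step. -/
lemma erwsStepProb_eq (p q r : ℝ) (hpqr : p + q + r = 1) {n : ℕ} (hn : 1 ≤ n) {x : ℕ → ℝ}
    (hx : ∀ k, x k ∈ stepValues) :
    erwsStepProb p q r n x 1 + erwsStepProb p q r n x (-1) = (1 - r) * pathOnes n x / n ∧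
      erwsStepProb p q r n x 0 = 1 - (1 - r) * pathOnes n x / n := by
  have hn0 : (n : ℝ) ≠ 0 := by positivity
  constructor
  · rw [erwsStepProb, erwsStepProb, ← Finset.sum_add_distrib, pathOnes, Finset.mul_sum,
      Finset.sum_div]
    refine Finset.sum_congr rfl fun k _ => ?_
    obtain rfl : r = 1 - p - q := by linarith
    -- Index by index: `x k = ±1` gives a nonzero step with probability `p + q`, and `x k = 0` never
    -- does.
    rcases mem_stepValues.mp (hx k) with h | h | h <;> rw [h] <;> norm_num <;> ring
  · have h1 : (1 : ℝ) = ∑ k ∈ Finset.Icc 1 n, (1 / (n : ℝ)) := by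
      simp [hn0]
    rw [pathOnes, Finset.mul_sum, Finset.sum_div, eq_sub_iff_add_eq]
    refine Eq.trans ?_ h1.symm
    rw [erwsStepProb, ← Finset.sum_add_distrib]
    refine Finset.sum_congr rfl fun k _ => ?_
    obtain rfl : r = 1 - p - q := by linarith
    rcases mem_stepValues.mp (hx k) with h | h | h <;> rw [h] <;> norm_num <;> ring

/-! ### One-step conditioning and rising factorial moments. -/

namespace IsERWS

variable {Ω : Type*} [MeasurableSpace Ω] {μ : Measure Ω} {p q r s : ℝ} {X : ℕ → Ω → ℝ}

lemma measurable_pathUpTo (hX : IsERWS μ p q r s X) (n : ℕ) : Measurable (pathUpTo X n) := by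
  refine measurable_pi_lambda _ fun k => ?_
  unfold pathUpTo
  split_ifs
  · exact hX.measurable k
  · exact measurable_const

lemma measurable_numOnes (hX : IsERWS μ p q r s X) (n : ℕ) : Measurable (numOnes X n) := by
  unfold numOnes
  exact Finset.measurable_fun_sum _ fun k _ => (hX.measurable k).pow_const 2

/-- The joint law of the first `n` steps and the next one. -/
lemma real_path_step (hX : IsERWS μ p q r s X) {n : ℕ} (hn : 1 ≤ n) {x : ℕ → ℝ}
    (hx : x ∈ pathValues n) (y : ℝ) :
    μ.real (pathUpTo X n ⁻¹' {x} ∩ X (n + 1) ⁻¹' {y})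
      = μ.real (pathUpTo X n ⁻¹' {x}) * erwsStepProb p q r n x y := by
  have hmem : ∀ k ∈ Finset.Icc 1 n, Function.update x (n + 1) y k = x k := fun k hk => by
    rw [Function.update_of_ne]
    simp only [Finset.mem_Icc] at hk
    omega
  have h := hX.step n hn (Function.update x (n + 1) y)
  rw [Function.update_self] at h
  have h1 : {ω | ∀ k ∈ Finset.Icc 1 n, X k ω = Function.update x (n + 1) y k}
      = pathUpTo X n ⁻¹' {x} := by
    rw [preimage_pathUpTo fun k => (mem_pathValues hx k).2]
    ext ω
    exact forall₂_congr fun k hk => by rw [hmem k hk]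
  have h2 : {ω | ∀ k ∈ Finset.Icc 1 (n + 1), X k ω = Function.update x (n + 1) y k}
      = pathUpTo X n ⁻¹' {x} ∩ X (n + 1) ⁻¹' {y} := by
    rw [← h1]
    ext ω
    simp only [Set.mem_ofPred_eq, Set.mem_inter_iff, Set.mem_preimage, Set.mem_singleton_iff]
    rw [← Finset.insert_Icc_right_eq_Icc_add_one (by omega), Finset.forall_mem_insert,
      Function.update_self, and_comm]
  have h3 : erwsStepProb p q r n (Function.update x (n + 1) y) y = erwsStepProb p q r n x y :=
    Finset.sum_congr rfl fun k hk => by rw [hmem k hk]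
  rw [h1, h2, h3] at h
  exact h

variable [IsProbabilityMeasure μ]

lemma ae_first (hX : IsERWS μ p q r s X) : ∀ᵐ ω ∂μ, X 1 ω = 1 ∨ X 1 ω = -1 := by
  have hm : ∀ y, MeasurableSet {ω | X 1 ω = y} := fun y =>
    hX.measurable 1 (measurableSet_singleton y)
  have hd : Disjoint {ω | X 1 ω = 1} {ω | X 1 ω = -1} := by
    rw [Set.disjoint_left]
    intro ω (h : X 1 ω = 1) (h' : X 1 ω = -1)
    rw [h] at h'
    norm_num at h'
  have h := measureReal_union (μ := μ) hd (hm (-1))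
  rw [hX.first_right, hX.first_left, add_sub_cancel] at h
  have h0 : μ.real ({ω | X 1 ω = 1} ∪ {ω | X 1 ω = -1})ᶜ = 0 := by
    rw [probReal_compl_eq_one_sub ((hm 1).union (hm (-1))), h, sub_self]
  rw [ae_iff]
  rw [measureReal_eq_zero_iff] at h0
  convert h0 using 2
  ext ω
  simp

lemma ae_path_step (hX : IsERWS μ p q r s X) (hpqr : p + q + r = 1) {n : ℕ} (hn : 1 ≤ n)
    {x : ℕ → ℝ} (hx : x ∈ pathValues n) :
    ∀ᵐ ω ∂μ, pathUpTo X n ω = x → X (n + 1) ω ∈ stepValues := by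
  set A := pathUpTo X n ⁻¹' {x} with hA
  have hAm : MeasurableSet A := hX.measurable_pathUpTo n (measurableSet_singleton x)
  have hB : MeasurableSet (X (n + 1) ⁻¹' (stepValues : Set ℝ)) :=
    hX.measurable (n + 1) stepValues.measurableSet
  have hU : A ∩ X (n + 1) ⁻¹' (stepValues : Set ℝ)
      = ⋃ y ∈ stepValues, A ∩ X (n + 1) ⁻¹' {y} := by
    ext ω; simp
  -- The three step probabilities add up to 1, so no mass of `A` is left for other values.
  have h1 : μ.real (A ∩ X (n + 1) ⁻¹' (stepValues : Set ℝ)) = μ.real A := by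
    rw [hU, measureReal_biUnion_finset]
    · rw [Finset.sum_congr rfl fun y _ => hX.real_path_step hn hx y, ← Finset.mul_sum]
      obtain ⟨h2, h3⟩ := erwsStepProb_eq p q r hpqr hn fun k => (mem_pathValues hx k).1
      rw [stepValues, Finset.sum_insert (by norm_num), Finset.sum_pair (by norm_num)]
      rw [show ∀ a b c : ℝ, a + (b + c) = (c + a) + b by intros; ring, h2, h3]
      ring
    · intro y _ z _ hyz
      refine Set.disjoint_left.mpr fun ω h h' => hyz ?_
      exact h.2.symm.trans h'.2
    · exact fun y _ => hAm.inter (hX.measurable _ (measurableSet_singleton y))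
  have h0 : μ.real (A \ X (n + 1) ⁻¹' (stepValues : Set ℝ)) = 0 := by
    have := measureReal_inter_add_sdiff (μ := μ) (s := A) hB
    linarith
  rw [measureReal_eq_zero_iff] at h0
  rw [ae_iff]
  convert h0 using 2
  ext ω
  simp [hA]

lemma ae_mem_pathValues (hX : IsERWS μ p q r s X) (hpqr : p + q + r = 1) (n : ℕ) :
    ∀ᵐ ω ∂μ, pathUpTo X n ω ∈ pathValues n := by
  have hstep : ∀ n ω, pathUpTo X n ω ∈ pathValues n → X (n + 1) ω ∈ stepValues →
      pathUpTo X (n + 1) ω ∈ pathValues (n + 1) := fun n ω h1 h2 => by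
    classical
    rw [pathUpTo_succ, pathValues, Finset.mem_image]
    exact ⟨(pathUpTo X n ω, X (n + 1) ω), Finset.mem_product.mpr ⟨h1, h2⟩, rfl⟩
  have h0 : ∀ ω, pathUpTo X 0 ω ∈ pathValues 0 := fun ω => by
    rw [pathValues, Finset.mem_singleton]
    funext k
    simp [pathUpTo]
  induction n with
  | zero => exact ae_of_all _ h0
  | succ n ih =>
    rcases Nat.eq_zero_or_pos n with rfl | hn
    · filter_upwards [hX.ae_first] with ω hω
      refine hstep 0 ω (h0 ω) (mem_stepValues.mpr ?_)
      tauto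
    · have h : ∀ᵐ ω ∂μ, ∀ x ∈ pathValues n, pathUpTo X n ω = x → X (n + 1) ω ∈ stepValues :=
        (Finset.eventually_all _).mpr fun x hx => hX.ae_path_step hpqr hn hx
      filter_upwards [ih, h] with ω h1 h2
      exact hstep n ω h1 (h2 _ h1 rfl)

lemma ae_mem_stepValues (hX : IsERWS μ p q r s X) (hpqr : p + q + r = 1) (n : ℕ) :
    ∀ᵐ ω ∂μ, X (n + 1) ω ∈ stepValues := by
  filter_upwards [hX.ae_mem_pathValues hpqr (n + 1)] with ω hω
  simpa [pathUpTo] using (mem_pathValues hω (n + 1)).1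

lemma ae_one_le_numOnes (hX : IsERWS μ p q r s X) :
    ∀ᵐ ω ∂μ, ∀ n, 1 ≤ numOnes X (n + 1) ω := by
  filter_upwards [hX.ae_first] with ω hω n
  have h1 : X 1 ω ^ 2 = 1 := by rcases hω with h | h <;> simp [h]
  calc (1 : ℝ) = X 1 ω ^ 2 := h1.symm
    _ ≤ _ := Finset.single_le_sum (f := fun k => X k ω ^ 2) (fun k _ => sq_nonneg _)
        (by simp)

/-- A function of the path and of the number of ones, whose expectation is conditioned one step
back: the next step is nonzero with probability `(1 - r) Σ_n / n`. -/
lemma integral_succ (hX : IsERWS μ p q r s X) (hpqr : p + q + r = 1) {n : ℕ} (hn : 1 ≤ n)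
    (φ : (ℕ → ℝ) → ℝ → ℝ) :
    ∫ ω, φ (pathUpTo X n ω) (X (n + 1) ω ^ 2) ∂μ
      = ∫ ω, (φ (pathUpTo X n ω) 0 + (1 - r) * numOnes X n ω / n *
          (φ (pathUpTo X n ω) 1 - φ (pathUpTo X n ω) 0)) ∂μ := by
  have h1 := integral_comp_of_finite (μ := μ) (V := fun ω => (pathUpTo X n ω, X (n + 1) ω))
    (T := pathValues n ×ˢ stepValues) ((hX.measurable_pathUpTo n).prodMk (hX.measurable (n + 1)))
    (by
      filter_upwards [hX.ae_mem_pathValues hpqr n, hX.ae_mem_stepValues hpqr n] with ω h h'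
      exact Finset.mem_product.mpr ⟨h, h'⟩) (fun z => φ z.1 (z.2 ^ 2))
  have h2 := integral_comp_of_finite (μ := μ) (V := pathUpTo X n)
    (T := pathValues n) (hX.measurable_pathUpTo n) (hX.ae_mem_pathValues hpqr n)
    (fun x => φ x 0 + (1 - r) * pathOnes n x / n * (φ x 1 - φ x 0))
  simp only [pathOnes_pathUpTo] at h2
  rw [h1, h2, Finset.sum_product]
  refine Finset.sum_congr rfl fun x hx => ?_
  have h3 : ∀ y, μ.real ((fun ω => (pathUpTo X n ω, X (n + 1) ω)) ⁻¹' {(x, y)})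
      = μ.real (pathUpTo X n ⁻¹' {x}) * erwsStepProb p q r n x y := fun y => by
    rw [← hX.real_path_step hn hx y, ← Set.singleton_prod_singleton, Set.mk_preimage_prod]
  simp only [h3]
  obtain ⟨h4, h5⟩ := erwsStepProb_eq p q r hpqr hn fun k => (mem_pathValues hx k).1
  rw [stepValues, Finset.sum_insert (by norm_num), Finset.sum_pair (by norm_num), h5]
  -- Only the total mass of `±1` is known; it suffices because `φ` sees the step through its square.
  have h6 : erwsStepProb p q r n x (-1)
      = (1 - r) * pathOnes n x / n - erwsStepProb p q r n x 1 := by linarith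
  rw [h6]
  norm_num
  ring

lemma integrable_path (hX : IsERWS μ p q r s X) (hpqr : p + q + r = 1) (n : ℕ)
    (φ : (ℕ → ℝ) → ℝ) : Integrable (fun ω => φ (pathUpTo X n ω)) μ :=
  integrable_comp_of_finite (hX.measurable_pathUpTo n) (hX.ae_mem_pathValues hpqr n) φ

lemma integrable_numOnes (hX : IsERWS μ p q r s X) (hpqr : p + q + r = 1) (n : ℕ)
    (f : ℝ → ℝ) : Integrable (fun ω => f (numOnes X n ω)) μ := by
  simpa only [pathOnes_pathUpTo] using hX.integrable_path hpqr n fun x => f (pathOnes n x)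

/-- The rising factorial moments of the number of ones. -/
lemma integral_risingPow (hX : IsERWS μ p q r s X) (hpqr : p + q + r = 1) {m : ℝ} (hm : -1 < m)
    (n : ℕ) :
    ∫ ω, risingPow m (numOnes X (n + 1) ω) ∂μ
      = Real.Gamma (1 + m) *
        ∏ k ∈ Finset.range n, (1 + (1 - r) * m / ((k : ℝ) + 1)) := by
  induction n with
  | zero =>
    have h : (fun ω => risingPow m (numOnes X (0 + 1) ω)) =ᵐ[μ] fun _ => Real.Gamma (1 + m) := by
      filter_upwards [hX.ae_first] with ω hω
      have h1 : X 1 ω ^ 2 = 1 := by rcases hω with h | h <;> simp [h]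
      simp [numOnes, h1, risingPow]
    rw [integral_congr_ae h]
    simp
  | succ n ih =>
    have h := hX.integral_succ hpqr (n := n + 1) (by omega)
      (fun x z => risingPow m (pathOnes (n + 1) x + z))
    simp only [pathOnes_pathUpTo, ← numOnes_succ] at h
    rw [h, Finset.prod_range_succ, ← mul_assoc, ← ih, ← integral_mul_const]
    refine integral_congr_ae ?_
    filter_upwards [hX.ae_one_le_numOnes] with ω hω
    have hS := hω n
    -- `Σ ≥ 1` and `m > -1` make `Σ + m` positive; after this rewriting `Σ` cancels.
    rw [add_zero, risingPow_add_one (by linarith) (by linarith)]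
    push_cast
    field_simp
    ring

end IsERWS

/-! ### The martingale and its almost sure limit. -/

/-- The filtration generated by the steps `1, …, n + 1`. -/
noncomputable def pathFiltration {Ω : Type*} [mΩ : MeasurableSpace Ω] {X : ℕ → Ω → ℝ}
    (hX : ∀ n, Measurable (pathUpTo X n)) : Filtration ℕ mΩ where
  seq n := MeasurableSpace.comap (pathUpTo X (n + 1)) inferInstance
  mono' := by
    refine monotone_nat_of_le_succ fun n => ?_
    have h : pathUpTo X (n + 1)
        = (fun x k => if k ∈ Finset.Icc 1 (n + 1) then x k else 0) ∘ pathUpTo X (n + 1 + 1) := by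
      funext ω k
      simp only [pathUpTo, Function.comp_apply, Finset.mem_Icc]
      split_ifs <;> first | rfl | omega
    rw [h, ← MeasurableSpace.comap_comp]
    refine MeasurableSpace.comap_mono (Measurable.comap_le ?_)
    refine measurable_pi_lambda _ fun k => ?_
    split_ifs
    · exact measurable_pi_apply k
    · exact measurable_const
  le' n := (hX (n + 1)).comap_le

namespace IsERWS

variable {Ω : Type*} [MeasurableSpace Ω] {μ : Measure Ω} {p q r s : ℝ} {X : ℕ → Ω → ℝ}

lemma prod_growth_pos (hr1 : r < 1) (n : ℕ) :
    0 < ∏ k ∈ Finset.range n, (1 + (1 - r) / ((k : ℝ) + 1)) :=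
  Finset.prod_pos fun k _ => by
    have : 0 < 1 - r := by linarith
    positivity

variable [IsProbabilityMeasure μ]

lemma martingale_numOnes (hX : IsERWS μ p q r s X) (hpqr : p + q + r = 1) (hr1 : r < 1) :
    Martingale (fun n ω => numOnes X (n + 1) ω /
        ∏ k ∈ Finset.range n, (1 + (1 - r) / ((k : ℝ) + 1)))
      (pathFiltration hX.measurable_pathUpTo) μ := by
  refine martingale_of_setIntegral_eq_succ (fun n => ?_)
    (fun n => hX.integrable_numOnes hpqr (n + 1) fun x => x / _) fun n A hA => ?_
  · refine Measurable.stronglyMeasurable ?_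
    have h : Measurable fun x : ℕ → ℝ => pathOnes (n + 1) x /
        ∏ k ∈ Finset.range n, (1 + (1 - r) / ((k : ℝ) + 1)) := by
      unfold pathOnes
      exact (Finset.measurable_fun_sum _ fun k _ => (measurable_pi_apply k).pow_const 2).div_const _
    have h' := h.comp (comap_measurable (pathUpTo X (n + 1)))
    simp only [Function.comp_def, pathOnes_pathUpTo] at h'
    exact h'
  · obtain ⟨B, hB, rfl⟩ := hA
    have hA : MeasurableSet (pathUpTo X (n + 1) ⁻¹' B) := hX.measurable_pathUpTo (n + 1) hB
    rw [← integral_indicator hA, ← integral_indicator hA]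
    -- The indicator of `B` depends only on the past path, so it can be put inside `φ`.
    have h := hX.integral_succ hpqr (n := n + 1) (by omega)
      (fun x z => B.indicator (fun _ => (pathOnes (n + 1) x + z) /
        ∏ k ∈ Finset.range (n + 1), (1 + (1 - r) / ((k : ℝ) + 1))) x)
    have hI : ∀ (g : Ω → ℝ) (ω : Ω), (pathUpTo X (n + 1) ⁻¹' B).indicator g ω
        = B.indicator (fun _ => g ω) (pathUpTo X (n + 1) ω) := fun g ω => by
      by_cases hω : pathUpTo X (n + 1) ω ∈ B <;> simp [Set.indicator, hω]
    simp only [pathOnes_pathUpTo, ← numOnes_succ] at h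
    simp only [hI]
    rw [h]
    refine integral_congr_ae (ae_of_all _ fun ω => ?_)
    by_cases hω : pathUpTo X (n + 1) ω ∈ B
    · simp only [Set.indicator_of_mem hω]
      have h1 := prod_growth_pos hr1 n
      have h2 := prod_growth_pos hr1 (n + 1)
      rw [Finset.prod_range_succ] at h2 ⊢
      have h3 : 0 < 1 + (1 - r) / ((n : ℝ) + 1) := pos_of_mul_pos_right h2 h1.le
      push_cast
      generalize (∏ k ∈ Finset.range n, (1 + (1 - r) / ((k : ℝ) + 1))) = P at h1
      have h4 : (n : ℝ) + 1 + (1 - r) ≠ 0 := by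
        have : (0 : ℝ) ≤ n := n.cast_nonneg
        linarith
      field_simp
      ring
    · simp only [Set.indicator_of_notMem hω]
      simp

lemma exists_tendsto_numOnes (hX : IsERWS μ p q r s X) (hpqr : p + q + r = 1) (hr1 : r < 1) :
    ∃ Y : Ω → ℝ, Measurable Y ∧ ∀ᵐ ω ∂μ,
      Tendsto (fun n : ℕ => numOnes X (n + 1) ω / ((n : ℝ) + 1) ^ (1 - r)) atTop (𝓝 (Y ω)) := by
  have hM := hX.martingale_numOnes hpqr hr1
  have hbd : ∀ n : ℕ, eLpNorm (fun ω => numOnes X (n + 1) ω /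
      ∏ k ∈ Finset.range n, (1 + (1 - r) / ((k : ℝ) + 1))) 1 μ ≤ (1 : NNReal) := fun n => by
    have hpos := prod_growth_pos hr1 n
    have hE := hX.integral_risingPow hpqr (m := 1) (by norm_num) n
    -- At `m = 1` the rising power is `Σ` itself, so the normalised `L¹` norm is exactly 1.
    rw [mul_one, one_add_one_eq_two, Real.Gamma_two, one_mul] at hE
    rw [eLpNorm_one_eq_lintegral_enorm, ← ofReal_integral_norm_eq_lintegral_enorm
      (hX.integrable_numOnes hpqr (n + 1) fun x => x / _)]
    refine le_of_eq ?_
    have h : ∫ ω, ‖numOnes X (n + 1) ω /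
        ∏ k ∈ Finset.range n, (1 + (1 - r) / ((k : ℝ) + 1))‖ ∂μ = 1 := by
      refine Eq.trans ?_ (div_self hpos.ne')
      refine Eq.trans ?_ (congrArg (· / _) hE)
      rw [← integral_div]
      refine integral_congr_ae ?_
      filter_upwards [hX.ae_one_le_numOnes] with ω hω
      have hS : 0 < numOnes X (n + 1) ω := by linarith [hω n]
      have h1 := risingPow_nat_succ 0 hS
      simp only [zero_add, Nat.cast_one, Nat.cast_zero, risingPow_zero hS, add_zero, one_mul] at h1
      rw [h1, Real.norm_of_nonneg (by positivity)]
    rw [h]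
    simp
  have hlim := hM.submartingale.ae_tendsto_limitProcess hbd
  have hmeas := (Filtration.stronglyMeasurable_limit_process' (f := fun n ω =>
    numOnes X (n + 1) ω / ∏ k ∈ Finset.range n, (1 + (1 - r) / ((k : ℝ) + 1)))
    (ℱ := pathFiltration hX.measurable_pathUpTo) (μ := μ)).measurable
  -- The constant passes from the product normalisation to the power `(n + 1)^(1 - r)`.
  refine ⟨_, hmeas.mul_const (1 / Real.Gamma (1 + (1 - r))), ?_⟩
  filter_upwards [hlim] with ω hω
  refine (hω.mul (tendsto_prod_one_add_div (s := 1 - r) (by linarith))).congr fun n => ?_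
  have hpos := prod_growth_pos hr1 n
  rw [div_mul_div_cancel₀ hpos.ne']

/-! ### Moments, positivity and Laplace transform of the limit. -/

lemma integral_risingPow_div (hX : IsERWS μ p q r s X) (hpqr : p + q + r = 1) {m : ℝ}
    (hm : -1 < m) (n : ℕ) :
    ∫ ω, risingPow m (numOnes X (n + 1) ω) / (((n : ℝ) + 1) ^ (1 - r)) ^ m ∂μ
      = Real.Gamma (1 + m) * ((∏ k ∈ Finset.range n, (1 + (1 - r) * m / ((k : ℝ) + 1))) /
        ((n : ℝ) + 1) ^ ((1 - r) * m)) := by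
  rw [integral_div, hX.integral_risingPow hpqr hm, Real.rpow_mul (by positivity), mul_div_assoc]

lemma tendsto_integral_risingPow_div (hX : IsERWS μ p q r s X) (hr : 0 ≤ r) (hpqr : p + q + r = 1)
    (hr1 : r < 1) {m : ℝ} (hm : -1 < m) :
    Tendsto (fun n : ℕ => ∫ ω, risingPow m (numOnes X (n + 1) ω) /
        (((n : ℝ) + 1) ^ (1 - r)) ^ m ∂μ) atTop
      (𝓝 (Real.Gamma (1 + m) / Real.Gamma (1 + (1 - r) * m))) := by
  simp only [hX.integral_risingPow_div hpqr hm]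
  -- Since `0 < 1 - r ≤ 1`, `m > -1` implies `(1 - r) m > -1`.
  have h := (tendsto_prod_one_add_div (s := (1 - r) * m) (by nlinarith)).const_mul
    (Real.Gamma (1 + m))
  rwa [mul_one_div] at h

lemma exists_integral_risingPow_div_le (hX : IsERWS μ p q r s X) (hr : 0 ≤ r)
    (hpqr : p + q + r = 1) (hr1 : r < 1) {m : ℝ} (hm : -1 < m) :
    ∃ C : ℝ, ∀ n : ℕ, ∫ ω, risingPow m (numOnes X (n + 1) ω) /
        (((n : ℝ) + 1) ^ (1 - r)) ^ m ∂μ ≤ C := by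
  obtain ⟨C, hC⟩ := (hX.tendsto_integral_risingPow_div hr hpqr hr1 hm).bddAbove_range
  exact ⟨C, fun n => hC ⟨n, rfl⟩⟩

lemma exists_moment_bound (hX : IsERWS μ p q r s X) (hr : 0 ≤ r)
    (hpqr : p + q + r = 1) (hr1 : r < 1) (m : ℕ) :
    ∃ C : ℝ, ∀ n : ℕ, ∫ ω, |numOnes X (n + 1) ω / ((n : ℝ) + 1) ^ (1 - r)| ^ m ∂μ ≤ C := by
  obtain ⟨C, hC⟩ := hX.exists_integral_risingPow_div_le hr hpqr hr1 (m := m)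
    (by linarith [(m.cast_nonneg : (0 : ℝ) ≤ m)])
  refine ⟨C, fun n => le_trans (integral_mono_ae
    (hX.integrable_numOnes hpqr (n + 1) fun x => |x / _| ^ m)
    (hX.integrable_numOnes hpqr (n + 1) fun x => risingPow m x / _) ?_) (hC n)⟩
  filter_upwards [hX.ae_one_le_numOnes] with ω hω
  have hS : 0 < numOnes X (n + 1) ω := by linarith [hω n]
  rw [abs_of_pos (by positivity), div_pow, Real.rpow_natCast]
  gcongr
  exact pow_le_risingPow m hS

/-- After normalisation each factor `Σ + j` of the rising power behaves like `Σ`, since `j / n^(1 -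
r)` vanishes. A bound on moments of order `2m` lets the limit pass through the expectation. -/
lemma limit_moment (hX : IsERWS μ p q r s X) (hr : 0 ≤ r) (hpqr : p + q + r = 1)
    (hr1 : r < 1) {Y : Ω → ℝ} (hY : ∀ᵐ ω ∂μ,
      Tendsto (fun n : ℕ => numOnes X (n + 1) ω / ((n : ℝ) + 1) ^ (1 - r)) atTop (𝓝 (Y ω))) (m : ℕ) :
    Integrable (fun ω => Y ω ^ m) μ ∧
      ∫ ω, Y ω ^ m ∂μ = (m.factorial : ℝ) / Real.Gamma (1 + m * (1 - r)) := by
  have hm : (-1 : ℝ) < m := by linarith [(m.cast_nonneg : (0 : ℝ) ≤ m)]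
  have hα : 0 < 1 - r := by linarith
  obtain ⟨C, hC⟩ := hX.exists_moment_bound hr hpqr hr1 (m * 2)
  have hgrow : Tendsto (fun n : ℕ => ((n : ℝ) + 1) ^ (1 - r)) atTop atTop :=
    (tendsto_rpow_atTop hα).comp
      (tendsto_atTop_add_const_right _ _ tendsto_natCast_atTop_atTop)
  have hconv : ∀ᵐ ω ∂μ, Tendsto (fun n : ℕ => risingPow m (numOnes X (n + 1) ω) /
      (((n : ℝ) + 1) ^ (1 - r)) ^ (m : ℝ)) atTop (𝓝 (Y ω ^ m)) := by
    filter_upwards [hY, hX.ae_one_le_numOnes] with ω hω hS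
    simp only [Real.rpow_natCast]
    clear hC hm
    induction m with
    | zero =>
      refine tendsto_const_nhds.congr fun n => ?_
      rw [Nat.cast_zero, risingPow_zero (by linarith [hS n]), pow_zero, pow_zero, div_one]
    | succ m ih =>
      have h1 := ih.mul (hω.add (tendsto_const_nhds (x := (m : ℝ)).div_atTop hgrow))
      rw [add_zero, ← pow_succ] at h1
      refine h1.congr fun n => ?_
      rw [risingPow_nat_succ m (by linarith [hS n]), ← add_div, div_mul_div_comm, pow_succ]
  obtain ⟨h1, h2⟩ := tendsto_integral_of_sq_bound (C := (m.factorial : ℝ) ^ 2 * C)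
    (fun n => hX.integrable_numOnes hpqr (n + 1) fun x => risingPow m x / _)
    (fun n => hX.integrable_numOnes hpqr (n + 1) fun x => |risingPow m x / _| ^ 2) (fun n => by
      refine le_trans ?_ (mul_le_mul_of_nonneg_left (hC n) (by positivity))
      rw [← integral_const_mul]
      refine integral_mono_ae
        (hX.integrable_numOnes hpqr (n + 1) fun x => |risingPow m x / _| ^ 2)
        (hX.integrable_numOnes hpqr (n + 1) fun x => _ * |x / _| ^ (m * 2)) ?_
      filter_upwards [hX.ae_one_le_numOnes] with ω hω
      have hS : 0 < numOnes X (n + 1) ω := by linarith [hω n]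
      have hf := risingPow_le_factorial_mul_pow m (hω n)
      have hf0 := risingPow_pos hS (m := m) (by positivity)
      rw [abs_of_pos (by positivity), abs_of_pos (by positivity), pow_mul, ← mul_pow,
        div_pow (numOnes X (n + 1) ω), ← mul_div_assoc, Real.rpow_natCast]
      gcongr) hconv
  refine ⟨h1, ?_⟩
  rw [tendsto_nhds_unique h2 (hX.tendsto_integral_risingPow_div hr hpqr hr1 hm), add_comm 1 (m : ℝ),
    Real.Gamma_nat_eq_factorial, mul_comm (m : ℝ)]

/-- The expectations of the inverse square roots stay bounded, so by Fatou their liminf is almost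
surely finite; it would be infinite wherever the limit is zero. -/
lemma limit_pos (hX : IsERWS μ p q r s X) (hr : 0 ≤ r) (hpqr : p + q + r = 1)
    (hr1 : r < 1) {Y : Ω → ℝ} (hY : ∀ᵐ ω ∂μ,
      Tendsto (fun n : ℕ => numOnes X (n + 1) ω / ((n : ℝ) + 1) ^ (1 - r)) atTop (𝓝 (Y ω))) :
    ∀ᵐ ω ∂μ, 0 < Y ω := by
  obtain ⟨C, hC⟩ := hX.exists_integral_risingPow_div_le hr hpqr hr1 (m := -(1 / 2)) (by norm_num)
  have hmeas : ∀ n : ℕ, Measurable fun ω =>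
      ENNReal.ofReal (√(numOnes X (n + 1) ω / ((n : ℝ) + 1) ^ (1 - r)))⁻¹ := fun n =>
    ((hX.measurable_numOnes (n + 1)).div_const _).sqrt.inv.ennreal_ofReal
  have hbd : ∀ n : ℕ, ∫⁻ ω, ENNReal.ofReal
      (√(numOnes X (n + 1) ω / ((n : ℝ) + 1) ^ (1 - r)))⁻¹ ∂μ ≤ ENNReal.ofReal C := fun n => by
    rw [← ofReal_integral_eq_lintegral_ofReal
      (hX.integrable_numOnes hpqr (n + 1) fun x => (√(x / _))⁻¹)
      (ae_of_all _ fun ω => by positivity)]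
    refine ENNReal.ofReal_le_ofReal (le_trans (integral_mono_ae
      (hX.integrable_numOnes hpqr (n + 1) fun x => (√(x / _))⁻¹)
      (hX.integrable_numOnes hpqr (n + 1) fun x => risingPow (-(1 / 2)) x / _) ?_) (hC n))
    filter_upwards [hX.ae_one_le_numOnes] with ω hω
    have h := inv_sqrt_le_risingPow_neg_half (hω n)
    rw [Real.sqrt_div (by linarith [hω n]), inv_div, Real.rpow_neg (by positivity),
      ← Real.sqrt_eq_rpow, div_inv_eq_mul, div_eq_inv_mul]
    gcongr
  have hfatou : ∫⁻ ω, liminf (fun n : ℕ => ENNReal.ofReal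
      (√(numOnes X (n + 1) ω / ((n : ℝ) + 1) ^ (1 - r)))⁻¹) atTop ∂μ ≠ ⊤ := by
    refine ne_top_of_le_ne_top (ENNReal.ofReal_ne_top (r := C)) ((lintegral_liminf_le hmeas).trans ?_)
    exact (liminf_le_liminf (Eventually.of_forall hbd)).trans_eq (liminf_const _)
  filter_upwards [ae_lt_top (Measurable.liminf hmeas) hfatou, hY, hX.ae_one_le_numOnes]
    with ω h1 h2 h3
  have hpos : ∀ n : ℕ, 0 < numOnes X (n + 1) ω / ((n : ℝ) + 1) ^ (1 - r) := fun n => by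
    have := h3 n
    positivity
  refine lt_of_le_of_ne (ge_of_tendsto' h2 fun n => (hpos n).le) fun h0 => ?_
  rw [← h0] at h2
  have h4 : Tendsto (fun n : ℕ => √(numOnes X (n + 1) ω / ((n : ℝ) + 1) ^ (1 - r))) atTop
      (𝓝[>] 0) := by
    refine tendsto_nhdsWithin_iff.mpr ⟨?_, Eventually.of_forall fun n => Real.sqrt_pos.mpr (hpos n)⟩
    simpa using h2.sqrt
  have h5 := ENNReal.tendsto_ofReal_atTop.comp h4.inv_tendsto_nhdsGT_zero
  exact h1.ne h5.liminf_eq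

/-- The `m!` in the moments cancels the one in the exponential series; absolute summability
justifies exchanging sum and integral. -/
lemma limit_exp_hasSum (hX : IsERWS μ p q r s X) (hr : 0 ≤ r) (hpqr : p + q + r = 1)
    (hr1 : r < 1) {Y : Ω → ℝ} (hY : ∀ᵐ ω ∂μ,
      Tendsto (fun n : ℕ => numOnes X (n + 1) ω / ((n : ℝ) + 1) ^ (1 - r)) atTop (𝓝 (Y ω))) (t : ℝ) :
    HasSum (fun n : ℕ => t ^ n / Real.Gamma (1 + n * (1 - r)))
      (∫ ω, Real.exp (t * Y ω) ∂μ) := by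
  have hmom := hX.limit_moment hr hpqr hr1 hY
  have hpos := hX.limit_pos hr hpqr hr1 hY
  have key : ∀ (u : ℝ) (n : ℕ), ∫ ω, (u * Y ω) ^ n / n.factorial ∂μ
      = u ^ n / Real.Gamma (1 + n * (1 - r)) := fun u n => by
    simp only [mul_pow]
    rw [integral_div, integral_const_mul, (hmom n).2]
    have : (n.factorial : ℝ) ≠ 0 := by positivity
    field_simp
  have hint : ∀ n : ℕ, Integrable (fun ω => (t * Y ω) ^ n / n.factorial) μ := fun n => by
    simp only [mul_pow]
    exact ((hmom n).1.const_mul _).div_const _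
  have hnorm : ∀ n : ℕ, ∫ ω, ‖(t * Y ω) ^ n / n.factorial‖ ∂μ
      = |t| ^ n / Real.Gamma (1 + n * (1 - r)) := fun n => by
    rw [← key |t| n]
    refine integral_congr_ae ?_
    filter_upwards [hpos] with ω hω
    rw [norm_div, norm_pow, norm_mul, Real.norm_eq_abs, Real.norm_of_nonneg hω.le,
      Real.norm_of_nonneg (by positivity)]
  have hsum : Summable fun n : ℕ => ∫ ω, ‖(t * Y ω) ^ n / n.factorial‖ ∂μ := by
    simp only [hnorm]
    exact summable_mittagLeffler (by linarith) t
  have hexp : ∀ x : ℝ, ∑' n : ℕ, x ^ n / n.factorial = Real.exp x := fun x => by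
    rw [Real.exp_eq_exp_ℝ, NormedSpace.exp_eq_tsum_div]
  have h1 := hasSum_integral_of_summable_integral_norm hint hsum
  simp only [key, hexp] at h1
  exact h1

lemma limit_exp_integrable (hX : IsERWS μ p q r s X) (hr : 0 ≤ r) (hpqr : p + q + r = 1)
    (hr1 : r < 1) {Y : Ω → ℝ} (hY : ∀ᵐ ω ∂μ,
      Tendsto (fun n : ℕ => numOnes X (n + 1) ω / ((n : ℝ) + 1) ^ (1 - r)) atTop (𝓝 (Y ω)))
    (hYm : Measurable Y) (t : ℝ) :
    Integrable (fun ω => Real.exp (t * Y ω)) μ := by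
  have hpos := hX.limit_pos hr hpqr hr1 hY
  have habs : Integrable (fun ω => Real.exp (|t| * Y ω)) μ := by
    by_contra hni
    have hsum := hX.limit_exp_hasSum hr hpqr hr1 hY |t|
    -- Without integrability the integral is 0 by convention, yet the series has nonnegative terms
    -- and its zeroth term is 1.
    rw [integral_undef hni] at hsum
    have hnn : ∀ n : ℕ, 0 ≤ |t| ^ n / Real.Gamma (1 + n * (1 - r)) := fun n => by
      have : 0 ≤ n * (1 - r) := mul_nonneg n.cast_nonneg (by linarith)
      have := Real.Gamma_pos_of_pos (show 0 < 1 + n * (1 - r) by linarith)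
      positivity
    have h0 := le_hasSum hsum 0 fun n _ => hnn n
    norm_num at h0
  refine habs.mono' (hYm.const_mul t).exp.aestronglyMeasurable ?_
  filter_upwards [hpos] with ω hω
  rw [Real.norm_of_nonneg (Real.exp_pos _).le]
  gcongr
  exact le_abs_self t

end IsERWS

theorem lemma2p1 {Ω : Type*} [MeasurableSpace Ω] (μ : Measure Ω) [IsProbabilityMeasure μ]
    (p q r s : ℝ) (hp : 0 ≤ p) (hq : 0 ≤ q) (hr : 0 ≤ r) (hpqr : p + q + r = 1) (hr1 : r < 1)
    (hs0 : 0 ≤ s) (hs1 : s ≤ 1) (X : ℕ → Ω → ℝ) (hX : IsERWS μ p q r s X) :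
    ∃ Y : Ω → ℝ, Measurable Y ∧
      (∀ᵐ ω ∂μ, Tendsto (fun n : ℕ => numOnes X n ω / (n : ℝ) ^ (1 - r)) atTop (𝓝 (Y ω))) ∧
      IsMittagLeffler μ (1 - r) Y ∧
      (∀ᵐ ω ∂μ, 0 < Y ω) ∧
      (∀ m : ℕ, 1 ≤ m →
        MemLp Y m μ ∧
        Tendsto (fun n : ℕ =>
          eLpNorm (fun ω => numOnes X n ω / (n : ℝ) ^ (1 - r) - Y ω) m μ) atTop (𝓝 0)) ∧
      (∀ m : ℕ, 1 ≤ m →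
        Integrable (fun ω => Y ω ^ m) μ ∧
        ∫ ω, Y ω ^ m ∂μ = (m.factorial : ℝ) / Real.Gamma (1 + m * (1 - r))) := by
  obtain ⟨Y, hYm, hY⟩ := hX.exists_tendsto_numOnes hpqr hr1
  have hpos := hX.limit_pos hr hpqr hr1 hY
  refine ⟨Y, hYm, ?_, ⟨hYm.aemeasurable, hpos, hX.limit_exp_integrable hr hpqr hr1 hY hYm,
    hX.limit_exp_hasSum hr hpqr hr1 hY⟩, hpos, fun m hm => ?_, fun m _ => hX.limit_moment hr hpqr hr1 hY m⟩
  · filter_upwards [hY] with ω hω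
    rw [← tendsto_add_atTop_iff_nat 1]
    simpa using hω
  · obtain ⟨C, hC⟩ := hX.exists_moment_bound hr hpqr hr1 (m + 1)
    obtain ⟨h1, h2⟩ := tendsto_eLpNorm_of_moment_bound hm
      (fun n => ((hX.measurable_numOnes (n + 1)).div_const _).aestronglyMeasurable)
      (fun n => hX.integrable_numOnes hpqr (n + 1) fun x => |x / _| ^ (m + 1)) hC hY
    refine ⟨h1, ?_⟩
    rw [← tendsto_add_atTop_iff_nat 1]
    simpa using h2
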